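/- **Setting.** Let $D$ be a probability distribution on $\mathbb{R}^d\times\{\pm1\}$ with marginal $D_X$ on $\mathbb{R}^d$, and let $\mathbb{B}=\{w\in\mathbb{R}^d:\|w\|_2\le 1\}$. For $\gamma>0$ let $\ell_\gamma(w,D)=\mathbb{P}_{(X,Y)\sim D}[Y\langle w,X\rangle\le\gamma]$ and $\ell^*_\gamma(D)=\inf_{w\in\mathbb{B}}\ell_\gamma(w,D)$. For a sample $S=\{(x_i,y_i)\}_{i=1}^m$ let $\hat\ell_\gamma(w,S)=\frac1m|\{i: y_i\langle w,x_i\rangle\le\gamma\}|$ and $\hat\ell(w,S)=\frac1m|\{i: y_i\langle w,x_i\rangle\le0\}|$. A *margin-error minimization algorithm* $\mathcal{A}$ takes a margin $\gamma>0$, a training sample $S$ of any size $m$ and an unlabeled test sample $\tilde S_X$ of size $m$, and outputs, measurably in $(S,\tilde S_X)$, a predictor $\mathcal{A}_\gamma(S,\tilde S_X)\in\operatorname{argmin}_{w\in\mathbb{B}}\hat\ell_\gamma(w,S)$. Let $\ell_m(\mathcal{A}_\gamma,D)=\mathbb{E}[\hat\ell(\mathcal{A}_\gamma(S,\tilde S_X),\tilde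 S)]$, where $S,\tilde S\sim D^m$ are independent and $\tilde S_X$ is the unlabeled part of $\tilde S$. The *distribution-specific sample complexity* $m(\epsilon,\gamma,D)\in\mathbb{N}\cup\{\infty\}$ is the least $N$ such that $\ell_m(\mathcal{A}_\gamma,D)-\ell^*_\gamma(D)\le\epsilon$ for every margin-error minimization algorithm $\mathcal{A}$ and every $m\ge N$ (and $\infty$ if there is no such $N$). A real random variable $Z$ is *sub-Gaussian with relative moment* $\rho$ if, with $B=\rho\sqrt{\mathbb{E}[Z^2]}$, $\mathbb{E}[e^{tZ}]\le e^{B^2t^2/2}$ for all $t\in\mathbb{R}$. The distribution $D_X$ is *independently sub-Gaussian with relative moment* $\rho$, written $D_X\in\mathcal{D}^{\mathrm{sg}}_\rho$, if there is an orthonormal basis $a_1,\dots,a_d$ of $\mathbb{R}^d$ such that, for $X\sim D_X$, the variables $\langle X,a_1\rangle,\dots,\langle X,a_d\rangle$ are independent and each is sub-Gaussian with relative moment $\rho$. The *$\gamma$-adapted dimension* $k_\gamma(D_X)$ is the least positive integer $k$ for which there is a subspace $V\subseteq\mathbb{R}^d$ of dimension $d-k$ with $\mathbb{E}_{X\sim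 D_X}[\|P_VX\|^2]\le\gamma^2k$, where $P_V$ is the orthogonal projection onto $V$. **Theorem (lower bound for distributions in $\mathcal{D}^{\mathrm{sg}}_\rho$).** For every $\rho>0$ there are a constant $\beta>0$ and an integer $L_0$, depending only on $\rho$, such that for every dimension $d$, every distribution $D$ on $\mathbb{R}^d\times\{\pm1\}$ with $D_X\in\mathcal{D}^{\mathrm{sg}}_\rho$, every margin $\gamma>0$ with $k_\gamma(D_X)>L_0$, and every $\epsilon<\frac14-\ell^*_\gamma(D)$, $$m(\epsilon,\gamma,D)\ \ge\ \beta\,k_\gamma(D_X).$$ -/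

import Mathlib

open MeasureTheory ProbabilityTheory
open scoped ENNReal NNReal

noncomputable section

namespace MarginLearning

/-- The Euclidean space `ℝ^d`. -/
abbrev E (d : ℕ) : Type := EuclideanSpace ℝ (Fin d)

/-- A labelled example: a point of `ℝ^d` with a label in `{1, -1}`, the units of `ℤ`. -/
abbrev Example (d : ℕ) : Type := E d × ℤˣ

/-- The signed margin `y ⟨w, x⟩` of the predictor `w` on the example `(x, y)`. -/
def margin {d : ℕ} (w : E d) (p : Example d) : ℝ :=
  ((p.2 : ℤ) : ℝ) * inner ℝ w p.1

/-- The closed unit ball of `ℝ^d`, the set of predictors. -/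
def unitBall (d : ℕ) : Set (E d) := Metric.closedBall 0 1

/-- The `γ`-margin loss `P[Y ⟨w, X⟩ ≤ γ]`. -/
def marginLoss {d : ℕ} (γ : ℝ) (D : Measure (Example d)) (w : E d) : ℝ :=
  D.real {p | margin w p ≤ γ}

/-- The minimal (infimal) `γ`-margin loss over the unit ball. -/
def optMarginLoss {d : ℕ} (γ : ℝ) (D : Measure (Example d)) : ℝ :=
  ⨅ w : unitBall d, marginLoss γ D w

/-- The empirical `γ`-margin loss: the fraction of the sample with `y ⟨w, x⟩ ≤ γ`. -/
def empMarginLoss {d m : ℕ} (γ : ℝ) (w : E d) (S : Fin m → Example d) : ℝ :=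
  ((Finset.univ.filter fun i => margin w (S i) ≤ γ).card : ℝ) / (m : ℝ)

/-- The empirical misclassification error: the fraction of the sample with `y ⟨w, x⟩ ≤ 0`. -/
def empLoss {d m : ℕ} (w : E d) (S : Fin m → Example d) : ℝ :=
  ((Finset.univ.filter fun i => margin w (S i) ≤ 0).card : ℝ) / (m : ℝ)

/-- A margin-error minimization algorithm: from a margin `γ > 0`, a training sample of any size
`m`, and an unlabelled test sample of size `m`, it outputs a minimizer over the unit ball of the
empirical `γ`-margin loss on the training sample. Measurability in the samples makes its expected
loss meaningful. -/
structure MarginErrorMinimizer (d : ℕ) where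
  /-- The predictor that the algorithm outputs. -/
  predict : ℝ → (m : ℕ) → (Fin m → Example d) → (Fin m → E d) → E d
  measurable_predict : ∀ γ : ℝ, 0 < γ → ∀ m : ℕ,
    Measurable fun q : (Fin m → Example d) × (Fin m → E d) => predict γ m q.1 q.2
  predict_mem : ∀ γ : ℝ, 0 < γ → ∀ (m : ℕ) (S : Fin m → Example d) (T : Fin m → E d),
    predict γ m S T ∈ unitBall d
  predict_isMinOn : ∀ γ : ℝ, 0 < γ → ∀ (m : ℕ) (S : Fin m → Example d) (T : Fin m → E d),
    IsMinOn (fun w => empMarginLoss γ w S) (unitBall d) (predict γ m S T)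

/-- The expected error of the algorithm on the test sample, when the training and the test
sample are independent, each consisting of `m` independent draws from `D`. -/
def expectedLoss {d : ℕ} (A : MarginErrorMinimizer d) (γ : ℝ) (m : ℕ)
    (D : Measure (Example d)) : ℝ :=
  ∫ q : (Fin m → Example d) × (Fin m → Example d),
    empLoss (A.predict γ m q.1 fun i => (q.2 i).1) q.2
    ∂((Measure.pi fun _ : Fin m => D).prod (Measure.pi fun _ : Fin m => D))

/-- The distribution-specific sample complexity: the least `N` such that every margin-error
minimization algorithm has excess loss at most `ε` at every sample size `m ≥ N`
(`⊤` if there is no such `N`). -/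
def sampleComplexity {d : ℕ} (ε γ : ℝ) (D : Measure (Example d)) : ℕ∞ :=
  ⨅ (N : ℕ) (_ : ∀ A : MarginErrorMinimizer d, ∀ m : ℕ, N ≤ m →
    expectedLoss A γ m D - optMarginLoss γ D ≤ ε), (N : ℕ∞)

/-- `X` is sub-Gaussian with moment `B ≥ 0`: `E[exp (t X)] ≤ exp (B² t² / 2)` for all real `t`
(with `exp (t X)` integrable). -/
def IsSubGaussian {Ω : Type*} [MeasurableSpace Ω] (X : Ω → ℝ) (B : ℝ≥0) (μ : Measure Ω) : Prop :=
  HasSubgaussianMGF X (B ^ 2) μ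

/-- `X` is sub-Gaussian with relative moment `ρ`: sub-Gaussian with moment `B = ρ √(E[X²])`. -/
def HasRelativeMoment {Ω : Type*} [MeasurableSpace Ω] (X : Ω → ℝ) (ρ : ℝ) (μ : Measure Ω) :
    Prop :=
  IsSubGaussian X (ρ * √(∫ ω, X ω ^ 2 ∂μ)).toNNReal μ

/-- The distribution `μ` on `ℝ^d` is independently sub-Gaussian with relative moment `ρ`. -/
def IndepSubGaussian {d : ℕ} (ρ : ℝ) (μ : Measure (E d)) : Prop :=
  ∃ a : OrthonormalBasis (Fin d) ℝ (E d),
    iIndepFun (fun (i : Fin d) (x : E d) => (inner ℝ x (a i) : ℝ)) μ ∧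
    ∀ i, HasRelativeMoment (fun x : E d => (inner ℝ x (a i) : ℝ)) ρ μ

/-- The distribution `μ` on `ℝ^d` is `(b, k)`-limited: `E[‖P X‖²] ≤ b` for the orthogonal
projection `P` onto some subspace of dimension `d - k`. -/
def IsLimited {d : ℕ} (μ : Measure (E d)) (b : ℝ) (k : ℕ) : Prop :=
  ∃ V : Submodule ℝ (E d), Module.finrank ℝ V + k = d ∧
    ∫⁻ x, ‖V.starProjection x‖ₑ ^ 2 ∂μ ≤ ENNReal.ofReal b

/-- The `γ`-adapted dimension: the least positive integer `k` such that `μ` is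
`(γ² k, k)`-limited. For `d ≥ 1` it exists, since `k = d` qualifies. -/
def adaptedDim {d : ℕ} (γ : ℝ) (μ : Measure (E d)) : ℕ :=
  sInf {k : ℕ | 1 ≤ k ∧ IsLimited μ (γ ^ 2 * k) k}

end MarginLearning

end

/-! Write `n = 2m` for the number of training and test points together. If the Gram operator of
these points exceeds `n γ²`, every sign pattern on them is realized with margin above `γ` by a
predictor in the unit ball (`exists_margin_gt`). A minimizer that sees the test points can then fit
the training sample perfectly and still give every test point the same label. One minimizer aims at
`1` and one at `-1`; on such samples their test errors add up to at least `1`. If such samples have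
probability at least `1/2`, one of the two minimizers has expected loss at least `1/4`
(`half_le_expectedLoss_add_expectedLoss`).

The Gram bound comes from concentration. By minimality of the adapted dimension `k`, the coordinate
second moments, each capped at `γ²`, sum to some `T ≥ γ² (k - 1)` (`le_cappedTrace_of_adaptedDim`).
Shrinking the coordinates to these capped moments only decreases the quadratic form `‖∑ v j • ω
j‖²`, and no single coordinate dominates any more. For fixed `v` in the unit ball the shrunk form is
a sum of independent squares with mean `T ‖v‖²`, and Bernstein's inequality gives a failure
probability exponentially small in `T / γ²` (`measure_capped_form_deviation_le`). A union bound over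
a net of at most `9 ^ n` points makes the estimate uniform (`exists_event_gram_lower_bound`). This
works for `m` up to a constant multiple of `k`, the constant depending on `ρ` only. -/

namespace MarginLearning

/-! ### Nets of the unit ball and quadratic forms. -/

section Geometry

variable {V : Type*} [NormedAddCommGroup V] [NormedSpace ℝ V] [FiniteDimensional ℝ V]

/-- A `1/4`-separated subset of the unit ball has at most `9 ^ dim` points. -/
theorem card_le_of_quarter_separated (s : Finset V) (hs : ∀ c ∈ s, ‖c‖ ≤ 1)
    (h : ∀ c ∈ s, ∀ e ∈ s, c ≠ e → 1 / 4 ≤ ‖c - e‖) :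
    s.card ≤ 9 ^ Module.finrank ℝ V := by
  borelize V
  let μ : Measure V := Measure.addHaar
  -- Volume comparison: disjoint balls of radius `1/8` inside a ball of radius `9/8`, whence the
  -- ratio `9`.
  have hdisj : Set.Pairwise (s : Set V)
      (Function.onFun Disjoint fun c => Metric.ball c (1 / 8 : ℝ)) := by
    rintro c hc e he hce
    apply Metric.ball_disjoint_ball
    rw [dist_eq_norm]
    linarith [h c hc e he hce]
  have hsub : ⋃ c ∈ s, Metric.ball (c : V) (1 / 8) ⊆ Metric.ball (0 : V) (9 / 8) := by
    refine Set.iUnion₂_subset fun x hx => Metric.ball_subset_ball' ?_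
    rw [dist_zero_right]
    linarith [hs x hx]
  have hvol : (s.card : ℝ≥0∞) * ENNReal.ofReal ((1 / 8 : ℝ) ^ Module.finrank ℝ V) *
      μ (Metric.ball 0 1) ≤
      ENNReal.ofReal ((9 / 8 : ℝ) ^ Module.finrank ℝ V) * μ (Metric.ball 0 1) :=
    calc
      _ = μ (⋃ c ∈ s, Metric.ball (c : V) (1 / 8)) := by
        rw [measure_biUnion_finset hdisj fun c _ => measurableSet_ball]
        simp only [μ.addHaar_ball_of_pos _ (by norm_num : (0 : ℝ) < 1 / 8)]
        simp only [Finset.sum_const, nsmul_eq_mul, mul_assoc]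
      _ ≤ μ (Metric.ball (0 : V) (9 / 8)) := measure_mono hsub
      _ = _ := by
        simp only [μ.addHaar_ball_of_pos _ (by norm_num : (0 : ℝ) < 9 / 8)]
  have hle := (ENNReal.mul_le_mul_iff_left (Metric.measure_ball_pos _ _ zero_lt_one).ne'
    measure_ball_lt_top.ne).1 hvol
  have hreal : (s.card : ℝ) ≤ (9 : ℝ) ^ Module.finrank ℝ V := by
    have := ENNReal.toReal_le_of_le_ofReal (by positivity) hle
    simpa [div_eq_mul_inv, mul_pow] using this
  exact mod_cast hreal

/-- The unit ball has a `1/4`-net of at most `9 ^ dim` points. -/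
theorem exists_quarter_net (V : Type*) [NormedAddCommGroup V] [NormedSpace ℝ V]
    [FiniteDimensional ℝ V] :
    ∃ s : Finset V, s.card ≤ 9 ^ Module.finrank ℝ V ∧ (∀ c ∈ s, ‖c‖ ≤ 1) ∧
      ∀ x : V, ‖x‖ ≤ 1 → ∃ c ∈ s, ‖x - c‖ ≤ 1 / 4 := by
  classical
  let p : Finset V → Prop := fun s => (∀ c ∈ s, ‖c‖ ≤ 1) ∧
    ∀ c ∈ s, ∀ e ∈ s, c ≠ e → 1 / 4 ≤ ‖c - e‖
  let P : ℕ → Prop := fun n => ∃ s : Finset V, p s ∧ s.card = n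
  have hbound : ∀ n, P n → n ≤ 9 ^ Module.finrank ℝ V := by
    rintro _ ⟨s, hs, rfl⟩
    exact card_le_of_quarter_separated s hs.1 hs.2
  have h0 : P 0 := ⟨∅, ⟨by simp, by simp⟩, rfl⟩
  -- A separated set of maximal cardinality is a net: a point far from all of it could be added.
  obtain ⟨s, hs, hcard⟩ := Nat.findGreatest_spec (Nat.zero_le (9 ^ Module.finrank ℝ V)) h0
  refine ⟨s, hbound _ ⟨s, hs, rfl⟩, hs.1, fun x hx => ?_⟩
  by_contra! hfar
  have hxs : x ∉ s := fun hx' => by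
    have := hfar x hx'
    norm_num at this
  have hins : P (insert x s).card := by
    refine ⟨insert x s, ⟨?_, ?_⟩, rfl⟩
    · intro c hc
      rcases Finset.mem_insert.1 hc with rfl | hc
      exacts [hx, hs.1 c hc]
    · intro c hc e he hce
      rcases Finset.mem_insert.1 hc with hcx | hcs <;> rcases Finset.mem_insert.1 he with hex | hes
      · exact absurd (hcx.trans hex.symm) hce
      · exact hcx ▸ (hfar e hes).le
      · rw [norm_sub_rev]
        exact hex ▸ (hfar c hcs).le
      · exact hs.2 c hcs e hes hce
  have := Nat.le_findGreatest (hbound _ hins) hins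
  rw [Finset.card_insert_of_notMem hxs] at this
  omega

/-- A quadratic form that is small on a `1/4`-net of the unit ball is small on the unit ball. -/
theorem abs_apply_self_le_of_net {V : Type*} [NormedAddCommGroup V] [InnerProductSpace ℝ V]
    [FiniteDimensional ℝ V] (B : V →L[ℝ] V →L[ℝ] ℝ) (s : Finset V)
    (hs : ∀ x : V, ‖x‖ ≤ 1 → ∃ c ∈ s, ‖x - c‖ ≤ 1 / 4) {δ : ℝ}
    (hB : ∀ c ∈ s, |B c c| ≤ δ) (v : V) : |B v v| ≤ 16 / 7 * δ * ‖v‖ ^ 2 := by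
  have hcomp : IsCompact (Metric.closedBall (0 : V) 1) := isCompact_closedBall 0 1
  have hcont : Continuous fun x : V => |B x x| := by fun_prop
  obtain ⟨x, hx, hmax⟩ := hcomp.exists_isMaxOn ⟨0, by simp⟩ hcont.continuousOn
  rw [mem_closedBall_zero_iff] at hx
  set K : ℝ := |B x x| with hK
  have hK0 : 0 ≤ K := abs_nonneg _
  have hhom : ∀ y : V, |B y y| ≤ K * ‖y‖ ^ 2 := by
    intro y
    rcases eq_or_ne y 0 with rfl | hy
    · simp
    have hy' : 0 < ‖y‖ := norm_pos_iff.2 hy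
    have hunit : ‖(‖y‖⁻¹ • y)‖ ≤ 1 := by
      rw [norm_smul, norm_inv, norm_norm, inv_mul_cancel₀ hy'.ne']
    have h1 : |B (‖y‖⁻¹ • y) (‖y‖⁻¹ • y)| ≤ K := hmax (mem_closedBall_zero_iff.2 hunit)
    have h2 : B y y = ‖y‖ ^ 2 * B (‖y‖⁻¹ • y) (‖y‖⁻¹ • y) := by
      simp only [map_smul, smul_apply, smul_eq_mul]
      field_simp
    rw [h2, abs_mul, abs_of_nonneg (by positivity), mul_comm]
    gcongr
  obtain ⟨c, hc, hxc⟩ := hs x hx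
  -- Polarization writes the cross terms as a difference of diagonal values, so no symmetry of `B`
  -- is needed. The step `4` is the largest that keeps `4 (x - c)` in the unit ball; the
  -- parallelogram law then bounds the last term by `K / 2`, and `K ≤ δ + K/16 + K/2`.
  have hid : B x x = B c c - B (x - c) (x - c) +
      (B (x + (4 : ℝ) • (x - c)) (x + (4 : ℝ) • (x - c)) -
        B (x - (4 : ℝ) • (x - c)) (x - (4 : ℝ) • (x - c))) / 8 := by
    simp only [map_smul, map_add, map_sub, smul_apply,
      add_apply, sub_apply, smul_eq_mul]
    ring
  have hsq : ‖x - c‖ ^ 2 ≤ 1 / 16 := by nlinarith [norm_nonneg (x - c)]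
  have h4 : ‖(4 : ℝ) • (x - c)‖ ≤ 1 := by
    rw [norm_smul]
    norm_num
    linarith
  have hp := hhom (x + (4 : ℝ) • (x - c))
  have hm := hhom (x - (4 : ℝ) • (x - c))
  have hpar := parallelogram_law_with_norm ℝ x ((4 : ℝ) • (x - c))
  have hd : |B (x - c) (x - c)| ≤ K / 16 := (hhom _).trans (by nlinarith)
  have hsum : K * ‖x + (4 : ℝ) • (x - c)‖ ^ 2 + K * ‖x - (4 : ℝ) • (x - c)‖ ^ 2 ≤ 4 * K := by
    have h1 : ‖x‖ * ‖x‖ ≤ 1 := by nlinarith [norm_nonneg x]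
    have h2 : ‖(4 : ℝ) • (x - c)‖ * ‖(4 : ℝ) • (x - c)‖ ≤ 1 := by
      nlinarith [norm_nonneg ((4 : ℝ) • (x - c))]
    nlinarith
  have hKδ : K ≤ 16 / 7 * δ := by
    have e1 := abs_le.1 hp
    have e2 := abs_le.1 hm
    have e3 := abs_le.1 hd
    have e4 := abs_le.1 (hB c hc)
    have : |B x x| ≤ δ + K / 16 + K / 2 := by
      rw [hid, abs_le]
      constructor <;> linarith [e1.1, e1.2, e2.1, e2.2, e3.1, e3.2, e4.1, e4.2]
    rw [← hK] at this
    linarith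
  exact (hhom v).trans (by gcongr)

end Geometry

/-! ### Realizing all sign patterns with margin. -/

/-- If the Gram operator of finitely many vectors is bounded below by more than `γ ^ 2` times their
number, then every sign pattern is realized with margin larger than `γ` by a unit predictor. -/
theorem exists_margin_gt {ι F : Type*} [Fintype ι] [Nonempty ι] [NormedAddCommGroup F]
    [InnerProductSpace ℝ F] (x : ι → F) {c γ : ℝ} (hγ : 0 < γ)
    (hc : Fintype.card ι * γ ^ 2 < c)
    (hx : ∀ v : EuclideanSpace ℝ ι, c * ‖v‖ ^ 2 ≤ ‖∑ j, v j • x j‖ ^ 2)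
    (y : ι → ℝ) (hy : ∀ j, y j ^ 2 = 1) :
    ∃ w : F, ‖w‖ ≤ 1 ∧ ∀ j, γ < y j * inner ℝ w (x j) := by
  have hn : (0 : ℝ) < Fintype.card ι := by exact_mod_cast Fintype.card_pos
  have hc0 : 0 < c := lt_of_le_of_lt (by positivity) hc
  let A : EuclideanSpace ℝ ι →ₗ[ℝ] F :=
    { toFun := fun v => ∑ j, v j • x j
      map_add' := fun u v => by simp [add_smul, Finset.sum_add_distrib]
      map_smul' := fun r v => by simp [Finset.smul_sum, smul_smul] }
  let G : EuclideanSpace ℝ ι →ₗ[ℝ] EuclideanSpace ℝ ι :=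
    { toFun := fun v => WithLp.toLp 2 fun j => inner ℝ (A v) (x j)
      map_add' := fun u v => by ext j; simp [inner_add_left]
      map_smul' := fun r v => by ext j; simp [inner_smul_left] }
  have hG : ∀ v, inner ℝ (G v) v = ‖A v‖ ^ 2 := by
    intro v
    rw [← real_inner_self_eq_norm_sq, PiLp.inner_apply]
    conv_rhs => rw [show inner ℝ (A v) (A v) = inner ℝ (A v) (∑ j, v j • x j) from rfl]
    rw [inner_sum]
    refine Finset.sum_congr rfl fun j _ => ?_
    simp [G, inner_smul_right]
  have hinj : Function.Injective G := by
    rw [injective_iff_map_eq_zero]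
    intro v hv
    have h1 := hG v
    rw [hv, inner_zero_left] at h1
    have h2 : c * ‖v‖ ^ 2 ≤ ‖A v‖ ^ 2 := hx v
    rw [← h1] at h2
    have h3 : ‖v‖ ^ 2 ≤ 0 := by
      by_contra! h
      nlinarith
    exact norm_eq_zero.1 (by nlinarith [norm_nonneg v])
  -- The predictor is `A z`, whose margins all equal `t = √(c / n) > γ`, where `n` is the number of
  -- vectors. As `‖G z‖ = √c`, one gets `‖A z‖² = ⟪G z, z⟫ ≤ √c ‖z‖ ≤ ‖A z‖`, so `‖A z‖ ≤ 1`.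
  obtain ⟨z, hz⟩ := (LinearMap.injective_iff_surjective.1 hinj)
    (WithLp.toLp 2 fun j => √(c / Fintype.card ι) * y j)
  set t : ℝ := √(c / Fintype.card ι) with ht
  have ht2 : t ^ 2 * Fintype.card ι = c := by
    rw [ht, Real.sq_sqrt (by positivity)]
    field_simp
  have htγ : γ < t := by
    refine Real.lt_sqrt_of_sq_lt ?_
    rw [lt_div_iff₀ hn, mul_comm]
    exact hc
  have hnorm : ‖G z‖ ^ 2 = c := by
    rw [hz, EuclideanSpace.norm_sq_eq]
    simp only [Real.norm_eq_abs, sq_abs, mul_pow, hy, mul_one, Finset.sum_const, Finset.card_univ,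
      nsmul_eq_mul]
    rw [mul_comm, ht2]
  refine ⟨A z, ?_, fun j => ?_⟩
  · have h1 : ‖A z‖ ^ 2 ≤ ‖G z‖ * ‖z‖ := by
      rw [← hG z]
      exact real_inner_le_norm _ _
    have h2 : c * ‖z‖ ^ 2 ≤ ‖A z‖ ^ 2 := hx z
    have h3 : (‖A z‖ ^ 2) ^ 2 ≤ ‖A z‖ ^ 2 := by
      calc (‖A z‖ ^ 2) ^ 2 ≤ (‖G z‖ * ‖z‖) ^ 2 := by gcongr
        _ = c * ‖z‖ ^ 2 := by rw [mul_pow, hnorm]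
        _ ≤ _ := h2
    have h4 : ‖A z‖ ^ 2 ≤ 1 := by
      by_contra! h
      nlinarith
    exact (sq_le_one_iff₀ (norm_nonneg _)).1 h4
  · have h1 : inner ℝ (A z) (x j) = t * y j := by
      have := congrArg (fun u : EuclideanSpace ℝ ι => u j) hz
      simpa [G] using this
    rw [h1]
    nlinarith [hy j]


/-! ### Sub-Gaussian variables, their squares, and Bernstein's inequality. -/

section SubGaussian

variable {Ω : Type*} [MeasurableSpace Ω] {μ : Measure Ω}

/-- A sub-Gaussian random variable is centered. -/
theorem integral_eq_zero_of_hasSubgaussianMGF [IsProbabilityMeasure μ] {X : Ω → ℝ} {c : ℝ≥0}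
    (h : HasSubgaussianMGF X c μ) : ∫ ω, X ω ∂μ = 0 := by
  have hint : (0 : ℝ) ∈ interior (integrableExpSet X μ) := by
    rw [h.integrableExpSet_eq_univ, interior_univ]
    trivial
  have hd : HasDerivAt (mgf X μ) (∫ ω, X ω ∂μ) 0 := by
    simpa using hasDerivAt_mgf hint
  have hd2 : HasDerivAt (fun t : ℝ => Real.exp (c * t ^ 2 / 2)) 0 0 := by
    have : HasDerivAt (fun t : ℝ => (c : ℝ) * t ^ 2 / 2) 0 0 := by
      simpa using (((hasDerivAt_id (0 : ℝ)).pow 2).const_mul (c : ℝ)).div_const 2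
    simpa using this.exp
  -- The two sides of the sub-Gaussian bound agree at `t = 0`, so their derivatives there agree too.
  have hmin : IsLocalMin (fun t : ℝ => Real.exp (c * t ^ 2 / 2) - mgf X μ t) 0 := by
    refine Filter.Eventually.of_forall fun t => ?_
    simpa using h.mgf_le t
  have := hmin.hasDerivAt_eq_zero (hd2.sub hd)
  linarith

theorem hasSubgaussianMGF_mono {X : Ω → ℝ} {c c' : ℝ≥0}
    (h : HasSubgaussianMGF X c μ) (hc : c ≤ c') : HasSubgaussianMGF X c' μ :=
  ⟨h.integrable_exp_mul, fun t => (h.mgf_le t).trans (by gcongr)⟩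

/-- Even powers of a sub-Gaussian random variable are integrable. -/
theorem integrable_even_pow_of_hasSubgaussianMGF [IsFiniteMeasure μ] {X : Ω → ℝ} {c : ℝ≥0}
    (h : HasSubgaussianMGF X c μ) (n : ℕ) : Integrable (fun ω => (X ω ^ 2) ^ n) μ := by
  have := (h.memLp ((2 * n : ℕ) : ℝ≥0)).integrable_norm_rpow'
  refine this.congr (ae_of_all _ fun ω => ?_)
  simp only [ENNReal.coe_toReal, NNReal.coe_natCast]
  rw [Real.rpow_natCast, pow_mul, Real.norm_eq_abs, sq_abs]

/-- Even moments of a sub-Gaussian random variable. -/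
theorem integral_even_pow_le [IsFiniteMeasure μ] {X : Ω → ℝ} {c : ℝ≥0} (hc : 0 < c)
    (h : HasSubgaussianMGF X c μ) {n : ℕ} (hn : n ≠ 0) :
    ∫ ω, (X ω ^ 2) ^ n ∂μ ≤ n.factorial * (2 * (Real.exp 1 * c) ^ n) := by
  have hc' : (0 : ℝ) < c := hc
  have hn' : (0 : ℝ) < n := by exact_mod_cast Nat.pos_of_ne_zero hn
  -- This choice makes the exponent `c t² / 2` equal to `n`, and `(t²)^n` cancels the factor
  -- `(2n)^n` of `(2n)! ≤ n! (2n)^n`.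
  set t : ℝ := √(2 * n / c) with ht
  have ht2 : t ^ 2 = 2 * n / c := Real.sq_sqrt (by positivity)
  have htp : 0 < t := Real.sqrt_pos.2 (by positivity)
  have hpt : ∀ ω, (X ω ^ 2) ^ n ≤ ((2 * n).factorial / (t ^ 2) ^ n) *
      (Real.exp (t * X ω) + Real.exp (-t * X ω)) := by
    intro ω
    have h1 := Real.pow_div_factorial_le_exp |t * X ω| (abs_nonneg _) (2 * n)
    rw [pow_mul, sq_abs, mul_pow, mul_pow] at h1
    have h2 : Real.exp |t * X ω| ≤ Real.exp (t * X ω) + Real.exp (-t * X ω) := by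
      rcases abs_cases (t * X ω) with ⟨h, -⟩ | ⟨h, -⟩ <;> rw [h]
      · linarith [Real.exp_pos (-t * X ω)]
      · rw [neg_mul]
        linarith [Real.exp_pos (t * X ω)]
    have h3 := h1.trans h2
    rw [div_le_iff₀ (by positivity)] at h3
    rw [div_mul_eq_mul_div, le_div_iff₀ (by positivity)]
    linarith
  have hexp : Real.exp (c * t ^ 2 / 2) = Real.exp 1 ^ n := by
    rw [ht2, ← Real.exp_nat_mul]
    congr 1
    field_simp
  have hfac : ((2 * n).factorial : ℝ) ≤ n.factorial * (2 * n) ^ n := by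
    have h1 := Nat.factorial_mul_ascFactorial n n
    have h2 := Nat.ascFactorial_le_pow_add n n
    rw [← two_mul] at h1 h2
    rw [← h1]
    exact_mod_cast Nat.mul_le_mul_left _ h2
  calc ∫ ω, (X ω ^ 2) ^ n ∂μ
      ≤ ∫ ω, ((2 * n).factorial / (t ^ 2) ^ n) *
          (Real.exp (t * X ω) + Real.exp (-t * X ω)) ∂μ :=
        integral_mono (integrable_even_pow_of_hasSubgaussianMGF h n)
          (((h.integrable_exp_mul t).add (h.integrable_exp_mul (-t))).const_mul _) hpt
    _ = ((2 * n).factorial / (t ^ 2) ^ n) * (mgf X μ t + mgf X μ (-t)) := by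
        rw [integral_const_mul, integral_add (h.integrable_exp_mul t) (h.integrable_exp_mul (-t))]
        rfl
    _ ≤ ((n.factorial * (2 * n) ^ n) / (t ^ 2) ^ n) * (Real.exp 1 ^ n + Real.exp 1 ^ n) := by
        have h1 := h.mgf_le t
        have h2 := h.mgf_le (-t)
        rw [neg_sq, hexp] at h2
        rw [hexp] at h1
        have : 0 ≤ mgf X μ t + mgf X μ (-t) := add_nonneg mgf_nonneg mgf_nonneg
        gcongr
    _ = _ := by
        rw [ht2, div_pow, mul_pow (Real.exp 1)]
        field_simp
        ring

/-- Exponential moments of the square of a sub-Gaussian random variable. -/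
theorem mgf_sq_le [IsProbabilityMeasure μ] {X : Ω → ℝ} {c : ℝ≥0} (hc : 0 < c)
    (h : HasSubgaussianMGF X c μ) {s : ℝ} (hs : |s| * (Real.exp 1 * c) ≤ 1 / 2) :
    Integrable (fun ω => Real.exp (s * X ω ^ 2)) μ ∧
      mgf (fun ω => X ω ^ 2) μ s ≤
        Real.exp (s * ∫ ω, X ω ^ 2 ∂μ + 4 * (|s| * (Real.exp 1 * c)) ^ 2) := by
  set r : ℝ := |s| * (Real.exp 1 * c) with hr
  have hr0 : 0 ≤ r := by positivity
  have hr1 : r < 1 := by linarith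
  -- The `n!` in the moment bound cancels against the exponential series, leaving a geometric
  -- series. Its terms from `n = 2` on sum to `2 r² / (1 - r) ≤ 4 r²`, the error beyond the linear
  -- term.
  have hmom : ∀ u : ℝ, |u| = |s| → ∀ n : ℕ, n ≠ 0 →
      |∫ ω, (u * X ω ^ 2) ^ n / n.factorial ∂μ| ≤ 2 * r ^ n := by
    intro u hu n hn
    rw [integral_div]
    simp_rw [mul_pow u]
    rw [integral_const_mul, abs_div, abs_mul, abs_pow, hu, Nat.abs_cast, div_le_iff₀ (by positivity),
      abs_of_nonneg (integral_nonneg fun ω => by positivity)]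
    calc _ ≤ |s| ^ n * (n.factorial * (2 * (Real.exp 1 * c) ^ n)) := by
          gcongr
          exact integral_even_pow_le hc h hn
      _ = _ := by rw [hr]; ring
  have hkey : ∀ u : ℝ, |u| = |s| →
      HasSum (fun n : ℕ => ∫ ω, (u * X ω ^ 2) ^ n / n.factorial ∂μ)
        (∫ ω, Real.exp (u * X ω ^ 2) ∂μ) := by
    intro u hu
    have hgeo : Summable fun n : ℕ => 2 * r ^ n :=
      (summable_geometric_of_lt_one hr0 hr1).mul_left 2
    have h1 := hasSum_integral_of_summable_integral_norm (μ := μ)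
      (F := fun (n : ℕ) ω => (u * X ω ^ 2) ^ n / n.factorial) ?_ ?_
    · simpa [Real.exp_eq_exp_ℝ, NormedSpace.exp_eq_tsum_div] using h1
    · intro n
      simp_rw [mul_pow u]
      exact ((integrable_even_pow_of_hasSubgaussianMGF h n).const_mul _).div_const _
    · refine Summable.of_norm_bounded_eventually_nat hgeo ?_
      filter_upwards [Filter.eventually_ne_atTop 0] with n hn
      have := hmom |s| (abs_abs s) n hn
      refine le_trans (le_of_eq ?_) this
      rw [Real.norm_eq_abs]
      congr 2 with ω
      rw [Real.norm_eq_abs, abs_div, abs_pow, abs_mul, hu, Nat.abs_cast,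
        abs_of_nonneg (sq_nonneg (X ω))]
  have hbase : ∀ u : ℝ, |u| = |s| →
      |(∫ ω, Real.exp (u * X ω ^ 2) ∂μ) - (1 + u * ∫ ω, X ω ^ 2 ∂μ)| ≤ 4 * r ^ 2 := by
    intro u hu
    have h1 := (hasSum_nat_add_iff' 2).2 (hkey u hu)
    have h0 : ∑ i ∈ Finset.range 2, ∫ ω, (u * X ω ^ 2) ^ i / i.factorial ∂μ =
        1 + u * ∫ ω, X ω ^ 2 ∂μ := by
      simp [Finset.sum_range_succ, integral_const_mul]
    rw [h0] at h1
    have h2 : HasSum (fun n : ℕ => 2 * r ^ (n + 2)) (2 * r ^ 2 * (1 - r)⁻¹) := by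
      have e : (fun n : ℕ => 2 * r ^ (n + 2)) = fun n => 2 * r ^ 2 * r ^ n := by
        funext n
        ring
      rw [e]
      exact (hasSum_geometric_of_lt_one hr0 hr1).mul_left (2 * r ^ 2)
    have h3 := h1.norm_le_of_bounded h2 fun n => hmom u hu (n + 2) (by omega)
    refine h3.trans ?_
    have : (1 - r)⁻¹ ≤ 2 := by
      rw [inv_le_comm₀ (by linarith) (by norm_num)]
      linarith
    nlinarith [mul_le_mul_of_nonneg_left this (by positivity : 0 ≤ 2 * r ^ 2)]
  refine ⟨?_, ?_⟩
  · have habs : Integrable (fun ω => Real.exp (|s| * X ω ^ 2)) μ := by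
      -- A non-integrable function has Bochner integral `0`, whereas the series is at least its
      -- zeroth term `1`.
      refine Integrable.of_integral_ne_zero (ne_of_gt ?_)
      have h1 := hkey |s| (abs_abs s)
      have h2 := le_hasSum h1 0 fun n _ => integral_nonneg fun ω => by positivity
      simp at h2
      linarith
    refine habs.mono ?_ (ae_of_all _ fun ω => ?_)
    · have := h.aemeasurable
      exact (by fun_prop : AEMeasurable (fun ω => Real.exp (s * X ω ^ 2)) μ).aestronglyMeasurable
    · rw [Real.norm_eq_abs, Real.norm_eq_abs, Real.abs_exp, Real.abs_exp]
      gcongr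
      exact le_abs_self s
  · have h1 := (abs_le.1 (hbase s rfl)).2
    have h2 := Real.add_one_le_exp (s * ∫ ω, X ω ^ 2 ∂μ + 4 * r ^ 2)
    change ∫ ω, Real.exp (s * X ω ^ 2) ∂μ ≤ _
    linarith

/-- A two-sided Bernstein inequality. -/
theorem measure_bernstein_le [IsProbabilityMeasure μ] {ι : Type*} [Fintype ι] {Y : ι → Ω → ℝ}
    (hY : ∀ i, Measurable (Y i)) (hind : iIndepFun Y μ) {a b : ι → ℝ} {s t : ℝ} (hs : 0 ≤ s)
    (hint : ∀ i, ∀ u : ℝ, |u| = s → Integrable (fun ω => Real.exp (u * Y i ω)) μ)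
    (hmgf : ∀ i, ∀ u : ℝ, |u| = s → mgf (Y i) μ u ≤ Real.exp (u * a i + b i)) :
    μ.real {ω | t < |∑ i, Y i ω - ∑ i, a i|} ≤ 2 * Real.exp (∑ i, b i - s * t) := by
  have hint' : ∀ u : ℝ, |u| = s → Integrable (fun ω => Real.exp (u * (∑ i, Y i) ω)) μ :=
    fun u hu => hind.integrable_exp_mul_sum hY fun i _ => hint i u hu
  have hmgf' : ∀ u : ℝ, |u| = s → mgf (∑ i, Y i) μ u ≤ Real.exp (u * ∑ i, a i + ∑ i, b i) := by
    intro u hu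
    rw [hind.mgf_sum hY, Finset.mul_sum, ← Finset.sum_add_distrib, Real.exp_sum]
    exact Finset.prod_le_prod (fun i _ => mgf_nonneg) fun i _ => hmgf i u hu
  have hup := measure_ge_le_exp_mul_mgf (μ := μ) (X := ∑ i, Y i) (∑ i, a i + t) hs
    (hint' s (abs_of_nonneg hs))
  have hlo := measure_le_le_exp_mul_mgf (μ := μ) (X := ∑ i, Y i) (∑ i, a i - t)
    (neg_nonpos.2 hs) (hint' (-s) (by rw [abs_neg, abs_of_nonneg hs]))
  have hsub : {ω | t < |∑ i, Y i ω - ∑ i, a i|} ⊆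
      {ω | ∑ i, a i + t ≤ (∑ i, Y i) ω} ∪ {ω | (∑ i, Y i) ω ≤ ∑ i, a i - t} := by
    intro ω hω
    simp only [Set.mem_ofPred_eq, Set.mem_union, Finset.sum_apply] at hω ⊢
    rcases lt_abs.1 hω with h | h
    · left; linarith
    · right; linarith
  have h1 := hmgf' s (abs_of_nonneg hs)
  have h2 := hmgf' (-s) (by rw [abs_neg, abs_of_nonneg hs])
  calc _ ≤ _ := measureReal_mono hsub
    _ ≤ _ := measureReal_union_le _ _
    _ ≤ Real.exp (-s * (∑ i, a i + t)) * Real.exp (s * ∑ i, a i + ∑ i, b i) +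
        Real.exp (-(-s) * (∑ i, a i - t)) * Real.exp (-s * ∑ i, a i + ∑ i, b i) := by
      gcongr
      · exact hup.trans (by gcongr)
      · exact hlo.trans (by gcongr)
    _ = _ := by
      rw [← Real.exp_add, ← Real.exp_add, two_mul]
      congr 2 <;> ring

/-- If a doubly indexed family is independent, so are its rows. -/
theorem iIndepFun_rows {ι κ : Type*} [Countable ι] [Countable κ] {U : ι → κ → Ω → ℝ}
    (hU : ∀ i j, Measurable (U i j)) (h : iIndepFun (fun (p : ι × κ) => U p.1 p.2) μ) :
    iIndepFun (fun i ω j => U i j ω) μ := by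
  have := h.isProbabilityMeasure
  have hprob : ∀ i j, IsProbabilityMeasure (μ.map (U i j)) :=
    fun i j => Measure.isProbabilityMeasure_map (hU i j).aemeasurable
  rw [iIndepFun_iff_map_fun_eq_infinitePi_map (by fun_prop)]
  have hrow : ∀ i, μ.map (fun ω j => U i j ω) = Measure.infinitePi fun j => μ.map (U i j) :=
    fun i => (h.precomp (g := fun j => (i, j)) fun _ _ hj => (Prod.ext_iff.1 hj).2
      ).map_fun_eq_infinitePi_map (hU i)
  simp_rw [hrow]
  rw [← Measure.infinitePi_map_curry (fun i j => μ.map (U i j)),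
    ← h.map_fun_eq_infinitePi_map (X := fun p : ι × κ => U p.1 p.2) (fun p => hU p.1 p.2), Measure.map_map (by fun_prop) (by fun_prop)]
  rfl

end SubGaussian

/-! ### Coordinates of linear combinations of an independent sample. -/

section RandomVectors

variable {d : ℕ} {ι : Type*} [Fintype ι]

theorem iIndepFun_comp_measurePreserving {Ω Ω' κ : Type*} [Fintype κ] [MeasurableSpace Ω]
    [MeasurableSpace Ω'] {P : Measure Ω} {μ : Measure Ω'} {f : Ω → Ω'} (hf : MeasurePreserving f P μ)
    {U : κ → Ω' → ℝ} (hU : ∀ i, Measurable (U i)) (h : iIndepFun U μ) :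
    iIndepFun (fun i ω => U i (f ω)) P := by
  have := h.isProbabilityMeasure
  have : IsProbabilityMeasure P := ⟨by
    rw [← Set.preimage_univ (f := f), hf.measure_preimage MeasurableSet.univ.nullMeasurableSet,
      measure_univ]⟩
  rw [iIndepFun_iff_map_fun_eq_pi_map (f := fun i ω => U i (f ω))
    fun i => ((hU i).comp hf.measurable).aemeasurable]
  have h1 := h.map_fun_eq_pi_map fun i => (hU i).aemeasurable
  rw [← hf.map_eq, Measure.map_map (by fun_prop) hf.measurable] at h1
  simp_rw [Measure.map_map (hU _) hf.measurable] at h1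
  exact h1

/-- The `i`-th coordinate, in the basis `a`, of the combination `∑ j, v j • ω j`. -/
noncomputable def coordSum (a : OrthonormalBasis (Fin d) ℝ (E d)) (v : EuclideanSpace ℝ ι)
    (i : Fin d) (ω : ι → E d) : ℝ :=
  ∑ j, v j * inner ℝ (ω j) (a i)

@[fun_prop]
theorem measurable_coordSum (a : OrthonormalBasis (Fin d) ℝ (E d)) (v : EuclideanSpace ℝ ι)
    (i : Fin d) : Measurable (coordSum a v i) := by
  unfold coordSum
  fun_prop

variable {μ : Measure (E d)} [IsProbabilityMeasure μ] {a : OrthonormalBasis (Fin d) ℝ (E d)}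

theorem iIndepFun_coordinates
    (hind : iIndepFun (fun (i : Fin d) (x : E d) => (inner ℝ x (a i) : ℝ)) μ) :
    iIndepFun (fun (p : ι × Fin d) (ω : ι → E d) => (inner ℝ (ω p.1) (a p.2) : ℝ))
      (Measure.pi fun _ : ι => μ) := by
  refine iIndepFun_uncurry' (X := fun j i (ω : ι → E d) => (inner ℝ (ω j) (a i) : ℝ))
    (fun j i => by fun_prop) ?_ fun j => ?_
  · exact iIndepFun_pi (μ := fun _ : ι => μ) (X := fun _ (x : E d) i => (inner ℝ x (a i) : ℝ))
      fun j => by fun_prop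
  · exact iIndepFun_comp_measurePreserving (measurePreserving_eval (fun _ : ι => μ) j)
      (fun i => by fun_prop) hind

/-- All entries `⟨ω j, a i⟩` are jointly independent, over points and over coordinates, and
different `i` use disjoint blocks of them. -/
theorem iIndepFun_coordSum (v : EuclideanSpace ℝ ι)
    (hind : iIndepFun (fun (i : Fin d) (x : E d) => (inner ℝ x (a i) : ℝ)) μ) :
    iIndepFun (coordSum a v) (Measure.pi fun _ : ι => μ) := by
  have h1 : iIndepFun (fun (p : Fin d × ι) (ω : ι → E d) => (inner ℝ (ω p.2) (a p.1) : ℝ))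
      (Measure.pi fun _ : ι => μ) :=
    (iIndepFun_coordinates (ι := ι) hind).precomp (g := Prod.swap) Prod.swap_injective
  have h2 := iIndepFun_rows (U := fun i j (ω : ι → E d) => (inner ℝ (ω j) (a i) : ℝ))
    (fun i j => by fun_prop) h1
  exact h2.comp (fun _ u => ∑ j, v j * u j) fun _ => by fun_prop

theorem hasSubgaussianMGF_inner_eval {c : ℝ≥0} {i : Fin d}
    (h : HasSubgaussianMGF (fun x : E d => (inner ℝ x (a i) : ℝ)) c μ) (j : ι) :
    HasSubgaussianMGF (fun ω : ι → E d => (inner ℝ (ω j) (a i) : ℝ)) c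
      (Measure.pi fun _ : ι => μ) := by
  have hmp := measurePreserving_eval (fun _ : ι => μ) j
  rw [← hmp.map_eq] at h
  exact HasSubgaussianMGF.of_map (X := fun x : E d => (inner ℝ x (a i) : ℝ))
    hmp.measurable.aemeasurable h

theorem hasSubgaussianMGF_scaled {c : ℝ≥0} {i : Fin d}
    (h : HasSubgaussianMGF (fun x : E d => (inner ℝ x (a i) : ℝ)) c μ)
    (v : EuclideanSpace ℝ ι) (j : ι) :
    HasSubgaussianMGF (fun ω : ι → E d => v j * (inner ℝ (ω j) (a i) : ℝ)) (‖v j‖₊ ^ 2 * c)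
      (Measure.pi fun _ : ι => μ) := by
  have h1 := (hasSubgaussianMGF_inner_eval h j).const_mul (v j)
  have h2 : (⟨v j ^ 2, sq_nonneg _⟩ : ℝ≥0) = ‖v j‖₊ ^ 2 := by
    refine NNReal.coe_injective ?_
    change v j ^ 2 = ((‖v j‖₊ ^ 2 : ℝ≥0) : ℝ)
    rw [NNReal.coe_pow, coe_nnnorm, Real.norm_eq_abs, sq_abs]
  rwa [h2] at h1

theorem iIndepFun_scaled (v : EuclideanSpace ℝ ι) (i : Fin d) :
    iIndepFun (fun (j : ι) (ω : ι → E d) => v j * (inner ℝ (ω j) (a i) : ℝ))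
      (Measure.pi fun _ : ι => μ) :=
  iIndepFun_pi (μ := fun _ : ι => μ) (X := fun j (x : E d) => v j * (inner ℝ x (a i) : ℝ))
    fun j => by fun_prop

/-- Variance proxies of independent summands add up to `‖v‖² c`. -/
theorem hasSubgaussianMGF_coordSum {c : ℝ≥0} {i : Fin d}
    (h : HasSubgaussianMGF (fun x : E d => (inner ℝ x (a i) : ℝ)) c μ)
    {v : EuclideanSpace ℝ ι} (hv : ‖v‖ ≤ 1) :
    HasSubgaussianMGF (coordSum a v i) c (Measure.pi fun _ : ι => μ) := by
  have h1 := HasSubgaussianMGF.sum_of_iIndepFun (iIndepFun_scaled (μ := μ) (a := a) v i)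
    (s := Finset.univ) fun j _ => hasSubgaussianMGF_scaled h v j
  refine hasSubgaussianMGF_mono h1 ?_
  rw [← Finset.sum_mul]
  refine mul_le_of_le_one_left zero_le ?_
  rw [← NNReal.coe_le_coe, NNReal.coe_sum]
  have h2 := EuclideanSpace.norm_sq_eq v
  simp only [Real.norm_eq_abs, sq_abs] at h2
  simp only [NNReal.coe_pow, coe_nnnorm, Real.norm_eq_abs, sq_abs, NNReal.coe_one]
  rw [← h2]
  exact pow_le_one₀ (norm_nonneg v) hv

/-- The summands are independent and centered, so the second moments are variances and add. -/
theorem integral_coordSum_sq {c : ℝ≥0} {i : Fin d}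
    (h : HasSubgaussianMGF (fun x : E d => (inner ℝ x (a i) : ℝ)) c μ)
    (v : EuclideanSpace ℝ ι) :
    ∫ ω, coordSum a v i ω ^ 2 ∂(Measure.pi fun _ : ι => μ) =
      ‖v‖ ^ 2 * ∫ x, (inner ℝ x (a i) : ℝ) ^ 2 ∂μ := by
  have hj := hasSubgaussianMGF_scaled h v
  have hsum := HasSubgaussianMGF.sum_of_iIndepFun (iIndepFun_scaled (μ := μ) (a := a) v i)
    (s := Finset.univ) fun j _ => hj j
  have hfun : coordSum a v i =
      ∑ j, fun ω : ι → E d => v j * (inner ℝ (ω j) (a i) : ℝ) := by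
    funext ω
    simp [coordSum]
  have hvar := IndepFun.variance_sum (μ := Measure.pi fun _ : ι => μ) (s := Finset.univ)
    (X := fun (j : ι) (ω : ι → E d) => v j * (inner ℝ (ω j) (a i) : ℝ))
    (fun j _ => (hj j).memLp 2) fun j _ k _ hjk => (iIndepFun_scaled v i).indepFun hjk
  rw [← hfun, variance_of_integral_eq_zero (X := coordSum a v i) (by fun_prop)
    (integral_eq_zero_of_hasSubgaussianMGF hsum)] at hvar
  rw [hvar, EuclideanSpace.norm_sq_eq, Finset.sum_mul]
  refine Finset.sum_congr rfl fun j _ => ?_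
  rw [variance_of_integral_eq_zero (hj j).aemeasurable (integral_eq_zero_of_hasSubgaussianMGF (hj j))]
  simp_rw [mul_pow]
  rw [integral_const_mul, Real.norm_eq_abs, sq_abs]
  congr 1
  have hmp := measurePreserving_eval (fun _ : ι => μ) j
  conv_rhs => rw [← hmp.map_eq]
  rw [integral_map hmp.measurable.aemeasurable]
  exact (by fun_prop : Measurable fun x : E d => (inner ℝ x (a i) : ℝ) ^ 2).aestronglyMeasurable

end RandomVectors

/-! ### Lower bound for the Gram operator of a random sample. -/

section SmallestSingularValue

variable {d : ℕ} {ι : Type*} [Fintype ι]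

/-- The second moment of the `i`-th coordinate in the basis `a`. -/
noncomputable def secondMoment (μ : Measure (E d)) (a : OrthonormalBasis (Fin d) ℝ (E d))
    (i : Fin d) : ℝ :=
  ∫ x, (inner ℝ x (a i) : ℝ) ^ 2 ∂μ

theorem secondMoment_nonneg (μ : Measure (E d)) (a : OrthonormalBasis (Fin d) ℝ (E d))
    (i : Fin d) : 0 ≤ secondMoment μ a i :=
  integral_nonneg fun _ => sq_nonneg _

/-- The sum of the coordinate second moments, each capped at `b`. -/
noncomputable def cappedTrace (μ : Measure (E d)) (a : OrthonormalBasis (Fin d) ℝ (E d))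
    (b : ℝ) : ℝ :=
  ∑ i, min (secondMoment μ a i) b

/-- The factor by which capping at `b` reduces the `i`-th second moment. -/
noncomputable def capWeight (μ : Measure (E d)) (a : OrthonormalBasis (Fin d) ℝ (E d))
    (b : ℝ) (i : Fin d) : ℝ :=
  min (secondMoment μ a i) b / secondMoment μ a i

variable {μ : Measure (E d)} {a : OrthonormalBasis (Fin d) ℝ (E d)} {b : ℝ}

theorem capWeight_nonneg (hb : 0 ≤ b) (i : Fin d) : 0 ≤ capWeight μ a b i :=
  div_nonneg (le_min (secondMoment_nonneg μ a i) hb) (secondMoment_nonneg μ a i)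

theorem capWeight_le_one (i : Fin d) : capWeight μ a b i ≤ 1 :=
  div_le_one_of_le₀ (min_le_left _ _) (secondMoment_nonneg μ a i)

theorem capWeight_mul_secondMoment (hb : 0 ≤ b) (i : Fin d) :
    capWeight μ a b i * secondMoment μ a i = min (secondMoment μ a i) b := by
  rcases eq_or_ne (secondMoment μ a i) 0 with h | h
  · simp [h, hb]
  · exact div_mul_cancel₀ _ h

/-- Exponential moments of the capped square of a coordinate of a random combination. -/
theorem mgf_capWeight_mul_coordSum_sq_le [IsProbabilityMeasure μ] {ρ : ℝ} (hρ : 0 < ρ)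
    (hb : 0 ≤ b) {i : Fin d}
    (h : HasRelativeMoment (fun x : E d => (inner ℝ x (a i) : ℝ)) ρ μ)
    {v : EuclideanSpace ℝ ι} (hv : ‖v‖ ≤ 1) {u : ℝ}
    (hu : |u| * ((Real.exp 1 * ρ ^ 2 + 1) * b) ≤ 1 / 2) :
    Integrable (fun ω => Real.exp (u * (capWeight μ a b i * coordSum a v i ω ^ 2)))
        (Measure.pi fun _ : ι => μ) ∧
      mgf (fun ω => capWeight μ a b i * coordSum a v i ω ^ 2) (Measure.pi fun _ : ι => μ) u ≤
        Real.exp (u * (‖v‖ ^ 2 * min (secondMoment μ a i) b) +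
          4 * u ^ 2 * (Real.exp 1 * ρ ^ 2 + 1) ^ 2 * b * min (secondMoment μ a i) b) := by
  -- For a zero second moment the weight is the default `0 / 0 = 0`, and the variable vanishes
  -- identically.
  rcases (secondMoment_nonneg μ a i).eq_or_lt with h0 | hpos
  · simp [capWeight, ← h0, hb, mgf]
  set l := secondMoment μ a i with hl
  set τ := capWeight μ a b i with hτ
  have hτ0 : 0 ≤ τ := capWeight_nonneg hb i
  have hτl : τ * l = min l b := capWeight_mul_secondMoment hb i
  have hm0 : 0 ≤ min l b := le_min hpos.le hb
  set c : ℝ≥0 := (ρ * √l).toNNReal ^ 2 with hc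
  have hcr : (c : ℝ) = ρ ^ 2 * l := by
    rw [hc, NNReal.coe_pow, Real.coe_toNNReal _ (by positivity), mul_pow, Real.sq_sqrt hpos.le]
  have hc0 : 0 < c := by
    rw [← NNReal.coe_pos, hcr]
    positivity
  have hX : HasSubgaussianMGF (fun x : E d => (inner ℝ x (a i) : ℝ)) c μ := h
  have hg := hasSubgaussianMGF_coordSum hX hv
  have hE := integral_coordSum_sq hX v
  set α := Real.exp 1 * ρ ^ 2 + 1 with hα
  have hα0 : 0 < α := by positivity
  have hsc : |u * τ| * (Real.exp 1 * c) ≤ |u| * (α * min l b) := by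
    rw [abs_mul, abs_of_nonneg hτ0, hcr, ← hτl]
    have : 0 ≤ |u| * τ * l := by positivity
    rw [hα]
    linarith
  have hmb : min l b ≤ b := min_le_right _ _
  have hsc2 : |u| * (α * min l b) ≤ |u| * (α * b) := by gcongr
  obtain ⟨h1, h2⟩ := mgf_sq_le hc0 hg (s := u * τ) (by linarith)
  refine ⟨by simpa only [mul_assoc] using h1, ?_⟩
  rw [mgf_const_mul, mul_comm τ u]
  refine h2.trans ?_
  rw [hE]
  refine Real.exp_le_exp.2 ?_
  have e1 : u * τ * (‖v‖ ^ 2 * ∫ x, (inner ℝ x (a i) : ℝ) ^ 2 ∂μ) =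
      u * (‖v‖ ^ 2 * min l b) := by
    rw [← hτl, hl, secondMoment]
    ring
  rw [e1]
  refine add_le_add_right ?_ _
  calc 4 * (|u * τ| * (Real.exp 1 * c)) ^ 2 ≤ 4 * (|u| * (α * min l b)) ^ 2 := by gcongr
    _ = 4 * u ^ 2 * α ^ 2 * min l b * min l b := by
      rw [mul_pow, sq_abs]
      ring
    _ ≤ _ := by gcongr

/-- Concentration of the capped quadratic form at one vector of the unit ball. -/
theorem measure_capped_form_deviation_le [IsProbabilityMeasure μ] {ρ : ℝ} (hρ : 0 < ρ) (hb : 0 < b)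
    (hind : iIndepFun (fun (i : Fin d) (x : E d) => (inner ℝ x (a i) : ℝ)) μ)
    (hsub : ∀ i, HasRelativeMoment (fun x : E d => (inner ℝ x (a i) : ℝ)) ρ μ)
    {v : EuclideanSpace ℝ ι} (hv : ‖v‖ ≤ 1) :
    (Measure.pi fun _ : ι => μ).real
      {ω | cappedTrace μ a b / 5 <
        |∑ i, capWeight μ a b i * coordSum a v i ω ^ 2 - cappedTrace μ a b * ‖v‖ ^ 2|} ≤
      2 * Real.exp (-(cappedTrace μ a b / (400 * (Real.exp 1 * ρ ^ 2 + 1) ^ 2 * b))) := by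
  set α := Real.exp 1 * ρ ^ 2 + 1 with hα
  have hα1 : 1 ≤ α := by
    rw [hα]
    have : 0 < Real.exp 1 * ρ ^ 2 := by positivity
    linarith
  have hα0 : 0 < α := by linarith
  -- This `s` minimizes the exponent `4 s² α² b T - s T / 5`, where `T` is the capped trace. The
  -- summand `1` in `α` gives `α ≥ 1`, which keeps `s` in the range of the exponential moment bound.
  set s : ℝ := 1 / (40 * α ^ 2 * b) with hs
  have hs0 : 0 ≤ s := by positivity
  have hsb : s * (α * b) ≤ 1 / 2 := by
    have : s * (α * b) = 1 / (40 * α) := by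
      rw [hs]
      field_simp
    rw [this, div_le_div_iff₀ (by positivity) (by norm_num)]
    linarith
  have hmgf := fun (i : Fin d) (u : ℝ) (hu : |u| = s) =>
    mgf_capWeight_mul_coordSum_sq_le hρ hb.le (hsub i) hv (u := u) (by rw [hu]; exact hsb)
  have hbern := measure_bernstein_le (μ := Measure.pi fun _ : ι => μ)
    (Y := fun i ω => capWeight μ a b i * coordSum a v i ω ^ 2) (fun i => by fun_prop)
    ((iIndepFun_coordSum v hind).comp (fun i y => capWeight μ a b i * y ^ 2)
      fun i => by fun_prop)
    (a := fun i => ‖v‖ ^ 2 * min (secondMoment μ a i) b)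
    (b := fun i => 4 * s ^ 2 * α ^ 2 * b * min (secondMoment μ a i) b)
    (t := cappedTrace μ a b / 5) hs0 (fun i u hu => (hmgf i u hu).1) fun i u hu => by
      have hus : u ^ 2 = s ^ 2 := by rw [← sq_abs, hu]
      rw [← hus]
      exact (hmgf i u hu).2
  rw [← Finset.mul_sum, ← Finset.mul_sum] at hbern
  change (Measure.pi fun _ : ι => μ).real {ω | _ < |_ - ‖v‖ ^ 2 * cappedTrace μ a b|} ≤
    2 * Real.exp (4 * s ^ 2 * α ^ 2 * b * cappedTrace μ a b - _) at hbern
  rw [mul_comm (cappedTrace μ a b) (‖v‖ ^ 2)]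
  refine hbern.trans (le_of_eq ?_)
  congr 2
  rw [hs]
  field_simp
  ring

/-- The capped quadratic form of a sample, centered. -/
noncomputable def cappedForm (μ : Measure (E d)) (a : OrthonormalBasis (Fin d) ℝ (E d)) (b : ℝ)
    (ω : ι → E d) : EuclideanSpace ℝ ι →L[ℝ] EuclideanSpace ℝ ι →L[ℝ] ℝ :=
  ∑ i, capWeight μ a b i •
    (innerSL ℝ (WithLp.toLp 2 fun j => (inner ℝ (ω j) (a i) : ℝ))).smulRight
      (innerSL ℝ (WithLp.toLp 2 fun j => (inner ℝ (ω j) (a i) : ℝ))) -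
    cappedTrace μ a b •
      ∑ j, (EuclideanSpace.proj j : EuclideanSpace ℝ ι →L[ℝ] ℝ).smulRight
        (EuclideanSpace.proj j : EuclideanSpace ℝ ι →L[ℝ] ℝ)

theorem cappedForm_apply_self (ω : ι → E d) (v : EuclideanSpace ℝ ι) :
    cappedForm μ a b ω v v =
      ∑ i, capWeight μ a b i * coordSum a v i ω ^ 2 - cappedTrace μ a b * ‖v‖ ^ 2 := by
  have h : ∀ i, (inner ℝ (WithLp.toLp 2 fun j => (inner ℝ (ω j) (a i) : ℝ)) v : ℝ) =
      coordSum a v i ω := by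
    intro i
    simp [PiLp.inner_apply, coordSum]
  simp only [cappedForm, sub_apply, smul_apply, sum_apply, ContinuousLinearMap.smulRight_apply,
    smul_eq_mul, innerSL_apply_apply, h, PiLp.proj_apply, EuclideanSpace.norm_sq_eq,
    Real.norm_eq_abs, sq_abs]
  simp only [pow_two]

/-- By Parseval, with weights at most `1`; a lower bound for the capped form thus passes to the Gram
operator. -/
theorem sum_capWeight_mul_coordSum_sq_le (ω : ι → E d) (v : EuclideanSpace ℝ ι) :
    ∑ i, capWeight μ a b i * coordSum a v i ω ^ 2 ≤ ‖∑ j, v j • ω j‖ ^ 2 := by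
  rw [← a.sum_sq_norm_inner_left]
  refine Finset.sum_le_sum fun i _ => ?_
  have h : (inner ℝ (∑ j, v j • ω j) (a i) : ℝ) = coordSum a v i ω := by
    simp [sum_inner, inner_smul_left, coordSum]
  rw [h, Real.norm_eq_abs, sq_abs]
  exact mul_le_of_le_one_left (sq_nonneg _) (capWeight_le_one i)

/-- With probability at least `1/2` the Gram operator of a sample is bounded below by half the
capped trace, if the capped trace is large compared with the sample size. -/
theorem exists_event_gram_lower_bound [IsProbabilityMeasure μ] {ρ : ℝ} (hρ : 0 < ρ) (hb : 0 < b)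
    (hind : iIndepFun (fun (i : Fin d) (x : E d) => (inner ℝ x (a i) : ℝ)) μ)
    (hsub : ∀ i, HasRelativeMoment (fun x : E d => (inner ℝ x (a i) : ℝ)) ρ μ)
    (hcard : 4 * (9 : ℝ) ^ Fintype.card ι ≤
      Real.exp (cappedTrace μ a b / (400 * (Real.exp 1 * ρ ^ 2 + 1) ^ 2 * b))) :
    ∃ G : Set (ι → E d), MeasurableSet G ∧ 1 / 2 ≤ (Measure.pi fun _ : ι => μ).real G ∧
      ∀ ω ∈ G, ∀ v : EuclideanSpace ℝ ι,
        cappedTrace μ a b / 2 * ‖v‖ ^ 2 ≤ ‖∑ j, v j • ω j‖ ^ 2 := by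
  obtain ⟨s, hs, hs1, hnet⟩ := exists_quarter_net (EuclideanSpace ℝ ι)
  rw [finrank_euclideanSpace] at hs
  have hT0 : 0 ≤ cappedTrace μ a b :=
    Finset.sum_nonneg fun i _ => le_min (secondMoment_nonneg μ a i) hb.le
  set T := cappedTrace μ a b with hT
  let bad : EuclideanSpace ℝ ι → Set (ι → E d) := fun v =>
    {ω | T / 5 < |∑ i, capWeight μ a b i * coordSum a v i ω ^ 2 - T * ‖v‖ ^ 2|}
  have hbad : ∀ v, MeasurableSet (bad v) := fun v =>
    measurableSet_lt (by fun_prop) (by fun_prop)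
  have hmeas : MeasurableSet (⋃ v ∈ s, bad v) := s.measurableSet_biUnion fun v _ => hbad v
  refine ⟨(⋃ v ∈ s, bad v)ᶜ, hmeas.compl, ?_, fun ω hω v => ?_⟩
  · rw [probReal_compl_eq_one_sub hmeas]
    have h1 : (Measure.pi fun _ : ι => μ).real (⋃ v ∈ s, bad v) ≤
        ∑ v ∈ s, (Measure.pi fun _ : ι => μ).real (bad v) := measureReal_biUnion_finset_le _ _
    have h2 := Finset.sum_le_card_nsmul s _ _ fun v hv =>
      measure_capped_form_deviation_le (μ := μ) hρ hb hind hsub (hs1 v hv)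
    rw [nsmul_eq_mul, Real.exp_neg] at h2
    set e := Real.exp (T / (400 * (Real.exp 1 * ρ ^ 2 + 1) ^ 2 * b)) with he
    have he0 : 0 < e := Real.exp_pos _
    have h3 : (s.card : ℝ) * (2 * e⁻¹) ≤ 1 / 2 := by
      have : (s.card : ℝ) ≤ 9 ^ Fintype.card ι := by exact_mod_cast hs
      rw [← mul_assoc, ← div_eq_mul_inv, div_le_iff₀ he0]
      linarith
    linarith [h1.trans h2]
  · have hω' : ∀ c ∈ s, |cappedForm μ a b ω c c| ≤ T / 5 := by
      intro c hc
      rw [cappedForm_apply_self]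
      by_contra! h
      exact hω (Set.mem_biUnion hc h)
    -- The net costs a factor `16/7`, and `16/7 · 1/5 = 16/35 < 1/2`.
    have h1 := abs_apply_self_le_of_net (cappedForm μ a b ω) s hnet hω' v
    rw [cappedForm_apply_self] at h1
    have h2 := sum_capWeight_mul_coordSum_sq_le (μ := μ) (a := a) (b := b) ω v
    have h3 := (abs_le.1 h1).1
    have h4 : 0 ≤ T * ‖v‖ ^ 2 := by positivity
    linarith

end SmallestSingularValue

/-! ### From the adapted dimension to the capped trace. -/

section AdaptedDimension

variable {d : ℕ} {μ : Measure (E d)} {a : OrthonormalBasis (Fin d) ℝ (E d)}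

/-- The projection onto the span of part of an orthonormal basis. -/
theorem norm_starProjection_span_sq (I : Finset (Fin d)) (x : E d) :
    ‖(Submodule.span ℝ (Set.range fun i : I => a i)).starProjection x‖ ^ 2 =
      ∑ i ∈ I, (inner ℝ x (a i) : ℝ) ^ 2 := by
  classical
  set V := Submodule.span ℝ (Set.range fun i : I => a i) with hV
  rw [← a.sum_sq_inner_left, ← Finset.sum_subset (Finset.subset_univ I)]
  · refine Finset.sum_congr rfl fun i hi => ?_
    have hmem : a i ∈ V := Submodule.subset_span ⟨⟨i, hi⟩, rfl⟩
    rw [Submodule.inner_starProjection_left_eq_right, Submodule.starProjection_eq_self_iff.2 hmem]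
  · intro i _ hi
    have hmem : a i ∈ Vᗮ := by
      rw [hV, Submodule.mem_orthogonal]
      intro u hu
      induction hu using Submodule.span_induction with
      | mem u hu =>
        obtain ⟨j, rfl⟩ := hu
        exact a.orthonormal.2 fun h => hi (h ▸ j.2)
      | zero => simp
      | add u v _ _ hu hv => rw [inner_add_left, hu, hv, add_zero]
      | smul r u _ hu => rw [inner_smul_left, hu, mul_zero]
    rw [Submodule.inner_starProjection_left_eq_right,
      (Submodule.starProjection_apply_eq_zero_iff V).2 hmem, inner_zero_right]
    norm_num

theorem isLimited_of_sum_secondMoment_le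
    (hint : ∀ i, Integrable (fun x : E d => (inner ℝ x (a i) : ℝ) ^ 2) μ) {k : ℕ} {b : ℝ}
    {I : Finset (Fin d)} (hI : I.card + k = d) (hb : ∑ i ∈ I, secondMoment μ a i ≤ b) :
    IsLimited μ b k := by
  refine ⟨Submodule.span ℝ (Set.range fun i : I => a i), ?_, ?_⟩
  · rw [finrank_span_eq_card (b := fun i : I => a i)
      (a.orthonormal.linearIndependent.comp _ Subtype.val_injective), Fintype.card_coe, hI]
  · have h1 : ∀ x : E d,
        ‖(Submodule.span ℝ (Set.range fun i : I => a i)).starProjection x‖ₑ ^ 2 =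
          ENNReal.ofReal (∑ i ∈ I, (inner ℝ x (a i) : ℝ) ^ 2) := by
      intro x
      rw [← norm_starProjection_span_sq, ← ofReal_norm,
        ENNReal.ofReal_pow (norm_nonneg _)]
    simp_rw [h1]
    rw [← ofReal_integral_eq_lintegral_ofReal (integrable_finsetSum I fun i _ => hint i)
      (ae_of_all _ fun x => Finset.sum_nonneg fun i _ => sq_nonneg _),
      integral_finsetSum I fun i _ => hint i]
    exact ENNReal.ofReal_le_ofReal hb

/-- If `μ` is not `(b k, k)`-limited, the trace capped at `b` is at least `b k`. -/
theorem le_cappedTrace_of_not_isLimited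
    (hint : ∀ i, Integrable (fun x : E d => (inner ℝ x (a i) : ℝ) ^ 2) μ) {k : ℕ} {b : ℝ}
    (hb : 0 ≤ b) (hkd : k ≤ d) (h : ¬ IsLimited μ (b * k) k) : b * k ≤ cappedTrace μ a b := by
  classical
  have hnn : ∀ i, 0 ≤ min (secondMoment μ a i) b := fun i => le_min (secondMoment_nonneg μ a i) hb
  set F : Finset (Fin d) := Finset.univ.filter fun i => b < secondMoment μ a i with hF
  -- Either at least `k` coordinates exceed the cap and contribute `b` each, or those that do fit
  -- into a set `J` of size `k`. Outside `J` the cap is inactive, and the remaining moments exceed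
  -- `b k` because the coordinate subspace is no witness.
  rcases le_total k F.card with hk | hk
  · calc b * k ≤ ∑ i ∈ F, b := by
          rw [Finset.sum_const, nsmul_eq_mul, mul_comm]
          gcongr
      _ = ∑ i ∈ F, min (secondMoment μ a i) b :=
          Finset.sum_congr rfl fun i hi => (min_eq_right (Finset.mem_filter.1 hi).2.le).symm
      _ ≤ _ := Finset.sum_le_sum_of_subset_of_nonneg (Finset.subset_univ F) fun i _ _ => hnn i
  · obtain ⟨J, hFJ, hJ⟩ := Finset.exists_superset_card_eq hk (by simpa using hkd)
    have hcard : Jᶜ.card + k = d := by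
      rw [Finset.card_compl, hJ, Fintype.card_fin]
      omega
    have hlt : b * k < ∑ i ∈ Jᶜ, secondMoment μ a i := by
      by_contra! hle
      exact h (isLimited_of_sum_secondMoment_le hint hcard hle)
    refine hlt.le.trans ?_
    calc ∑ i ∈ Jᶜ, secondMoment μ a i = ∑ i ∈ Jᶜ, min (secondMoment μ a i) b := by
          refine Finset.sum_congr rfl fun i hi => (min_eq_left ?_).symm
          by_contra! hlt
          exact Finset.mem_compl.1 hi (hFJ (Finset.mem_filter.2 ⟨Finset.mem_univ i, hlt⟩))
      _ ≤ _ := Finset.sum_le_sum_of_subset_of_nonneg (Finset.subset_univ _) fun i _ _ => hnn i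

/-- Minimality rules out `k - 1`, an admissible candidate since `k ≥ 2`. That bound also excludes
the default `sInf ∅ = 0`, so `k` is attained and `k ≤ d`. -/
theorem le_cappedTrace_of_adaptedDim
    (hint : ∀ i, Integrable (fun x : E d => (inner ℝ x (a i) : ℝ) ^ 2) μ) {γ : ℝ}
    (hk : 2 ≤ adaptedDim γ μ) :
    γ ^ 2 * ((adaptedDim γ μ : ℝ) - 1) ≤ cappedTrace μ a (γ ^ 2) := by
  have hne : {k : ℕ | 1 ≤ k ∧ IsLimited μ (γ ^ 2 * k) k}.Nonempty := by
    by_contra! hempty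
    rw [adaptedDim, hempty, Nat.sInf_empty] at hk
    omega
  obtain ⟨-, V, hV, -⟩ := Nat.sInf_mem hne
  have hkd : adaptedDim γ μ ≤ d := by
    change _ + adaptedDim γ μ = d at hV
    omega
  have hnot : ¬ IsLimited μ (γ ^ 2 * (adaptedDim γ μ - 1 : ℕ)) (adaptedDim γ μ - 1) := by
    intro hlim
    have : adaptedDim γ μ ≤ adaptedDim γ μ - 1 := Nat.sInf_le ⟨by omega, hlim⟩
    omega
  have := le_cappedTrace_of_not_isLimited (a := a) hint (sq_nonneg γ) (by omega) hnot
  rwa [Nat.cast_sub (by omega), Nat.cast_one] at this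

end AdaptedDimension

/-! ### Measurable minimizers that favour one test label. -/

section Algorithm

variable {d : ℕ}

@[fun_prop]
theorem measurable_margin {α : Type*} [MeasurableSpace α] {w : α → E d} {p : α → Example d}
    (hw : Measurable w) (hp : Measurable p) : Measurable fun x => margin (w x) (p x) := by
  unfold margin
  have h : Measurable fun u : ℤˣ => ((u : ℤ) : ℝ) := 
    (measurable_from_top (f := fun n : ℤ => (n : ℝ))).comp (comap_measurable Units.val)
  exact (h.comp hp.snd).mul (hw.inner hp.fst)

theorem continuous_margin (p : Example d) : Continuous fun w : E d => margin w p := by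
  unfold margin
  fun_prop

theorem measurable_card_filter_margin_le {α : Type*} [MeasurableSpace α] {m : ℕ} {w : α → E d}
    {p : α → Fin m → Example d} (hw : Measurable w) (hp : Measurable p) (t : ℝ) :
    Measurable fun x => (Finset.univ.filter fun i => margin (w x) (p x i) ≤ t).card := by
  simp_rw [Finset.card_filter]
  refine Finset.measurable_sum _ fun i _ => Measurable.ite ?_ measurable_const measurable_const
  exact measurableSet_le (measurable_margin hw (by fun_prop)) measurable_const

instance : Nonempty (unitBall d) := ⟨⟨0, by simp [unitBall]⟩⟩

/-- A dense sequence of predictors in the unit ball. -/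
noncomputable def denseBall (d : ℕ) (n : ℕ) : E d :=
  (TopologicalSpace.denseSeq (unitBall d) n : E d)

theorem denseBall_mem (n : ℕ) : denseBall d n ∈ unitBall d :=
  (TopologicalSpace.denseSeq (unitBall d) n).2

/-- The dense sequence contains a predictor that exceeds every threshold that `w` exceeds. -/
theorem exists_denseBall_margin_gt {ι : Type*} [Finite ι] (p : ι → Example d) (t : ι → ℝ) {w : E d}
    (hw : w ∈ unitBall d) :
    ∃ n, ∀ i, t i < margin w (p i) → t i < margin (denseBall d n) (p i) := by
  -- Finitely many strict inequalities are an open condition. A countable family of predictors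
  -- therefore loses nothing, and it makes a measurable choice possible.
  let U : Set (unitBall d) := ⋂ i : ι, {u | t i < margin w (p i) → t i < margin u (p i)}
  have hU : IsOpen U := by
    refine isOpen_iInter_of_finite fun i => ?_
    by_cases h : t i < margin w (p i)
    · simp only [h, true_imp_iff]
      exact isOpen_lt continuous_const ((continuous_margin (p i)).comp continuous_subtype_val)
    · simp [h]
  obtain ⟨n, hn⟩ := (TopologicalSpace.denseRange_denseSeq (unitBall d)).exists_mem_open hU
    ⟨⟨w, hw⟩, Set.mem_iInter.2 fun i h => h⟩
  exact ⟨n, fun i => Set.mem_iInter.1 hn i⟩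

/-- The cost of a predictor: the number of training margin errors, and then the number of test
points that do not get the label `s`. -/
noncomputable def cost (s : ℤˣ) (γ : ℝ) {m : ℕ} (S : Fin m → Example d) (T : Fin m → E d)
    (w : E d) : ℕ :=
  -- The second count is at most `m`, so the factor `m + 1` makes the order lexicographic.
  (m + 1) * (Finset.univ.filter fun i => margin w (S i) ≤ γ).card +
    (Finset.univ.filter fun i => margin w (T i, s) ≤ 0).card

theorem exists_cost_minimal (s : ℤˣ) (γ : ℝ) {m : ℕ} (S : Fin m → Example d) (T : Fin m → E d) :
    ∃ n, ∀ k, cost s γ S T (denseBall d n) ≤ cost s γ S T (denseBall d k) := by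
  exact ⟨Function.argmin fun n => cost s γ S T (denseBall d n),
    fun k => Function.argmin_le (fun n => cost s γ S T (denseBall d n)) k⟩

open Classical in
/-- The first predictor of the dense sequence that minimizes the cost. -/
noncomputable def costMinimizer (s : ℤˣ) (γ : ℝ) {m : ℕ} (S : Fin m → Example d)
    (T : Fin m → E d) : E d :=
  denseBall d (Nat.find (exists_cost_minimal s γ S T))

theorem costMinimizer_mem (s : ℤˣ) (γ : ℝ) {m : ℕ} (S : Fin m → Example d) (T : Fin m → E d) :
    costMinimizer s γ S T ∈ unitBall d :=
  denseBall_mem _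

theorem cost_costMinimizer_le (s : ℤˣ) (γ : ℝ) {m : ℕ} (S : Fin m → Example d) (T : Fin m → E d)
    (k : ℕ) : cost s γ S T (costMinimizer s γ S T) ≤ cost s γ S T (denseBall d k) := by
  classical
  exact Nat.find_spec (exists_cost_minimal s γ S T) k

/-- The index is the first to satisfy a countable conjunction of comparisons between measurable
costs. -/
theorem measurable_costMinimizer (s : ℤˣ) (γ : ℝ) (m : ℕ) :
    Measurable fun q : (Fin m → Example d) × (Fin m → E d) => costMinimizer s γ q.1 q.2 := by
  classical
  have hcost : ∀ n, Measurable fun q : (Fin m → Example d) × (Fin m → E d) =>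
      cost s γ q.1 q.2 (denseBall d n) := fun n =>
    ((measurable_card_filter_margin_le measurable_const measurable_fst γ).const_mul _).add
      (measurable_card_filter_margin_le measurable_const (by fun_prop) 0)
  refine (measurable_from_nat (f := denseBall d)).comp (measurable_find _ fun n => ?_)
  simp only [Set.ofPred_forall]
  exact MeasurableSet.iInter fun k => measurableSet_le (hcost n) (hcost k)

/-- The margin-error minimizer that labels as many test points as possible by `s`. -/
noncomputable def constantLabelMinimizer (d : ℕ) (s : ℤˣ) : MarginErrorMinimizer d where
  predict γ _ S T := costMinimizer s γ S T
  measurable_predict γ _ m := measurable_costMinimizer s γ m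
  predict_mem γ _ _ S T := costMinimizer_mem s γ S T
  predict_isMinOn γ _ m S T := by
    intro w hw
    -- An arbitrary competitor is replaced by a member of the dense sequence with no more training
    -- margin errors.
    obtain ⟨n, hn⟩ := exists_denseBall_margin_gt S (fun _ => γ) hw
    have h1 := cost_costMinimizer_le s γ S T n
    have h2 : (Finset.univ.filter fun i => margin (denseBall d n) (S i) ≤ γ).card ≤
        (Finset.univ.filter fun i => margin w (S i) ≤ γ).card := by
      refine Finset.card_le_card fun i hi => ?_
      rw [Finset.mem_filter] at hi ⊢
      refine ⟨hi.1, ?_⟩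
      by_contra! h
      exact absurd (hn i h) (not_lt.2 hi.2)
    have h3 : (Finset.univ.filter fun i => margin (denseBall d n) (T i, s) ≤ 0).card ≤ m := by
      simpa using Finset.card_le_univ
        (Finset.univ.filter fun i => margin (denseBall d n) (T i, s) ≤ 0)
    have h4 : (Finset.univ.filter fun i => margin (costMinimizer s γ S T) (S i) ≤ γ).card ≤
        (Finset.univ.filter fun i => margin w (S i) ≤ γ).card := by
      unfold cost at h1
      by_contra! h
      nlinarith
    simp only [Set.mem_ofPred_eq, empMarginLoss]
    gcongr

/-- If the labels of the training sample and the label `s` on the test sample can be realized with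
margin, the output labels every test point by `s`. -/
theorem margin_constantLabelMinimizer_pos {s : ℤˣ} {γ : ℝ} {m : ℕ} {S : Fin m → Example d}
    {T : Fin m → E d} {w : E d} (hw : w ∈ unitBall d) (hS : ∀ i, γ < margin w (S i))
    (hT : ∀ i, 0 < margin w (T i, s)) (j : Fin m) :
    0 < margin ((constantLabelMinimizer d s).predict γ m S T) (T j, s) := by
  obtain ⟨n, hn⟩ := exists_denseBall_margin_gt (Sum.elim S fun i => (T i, s))
    (Sum.elim (fun _ => γ) fun _ => 0) hw
  have h1 : cost s γ S T (denseBall d n) = 0 := by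
    have e1 : ∀ i, ¬ margin (denseBall d n) (S i) ≤ γ := fun i => not_le.2 (hn (.inl i) (hS i))
    have e2 : ∀ i, ¬ margin (denseBall d n) (T i, s) ≤ 0 :=
      fun i => not_le.2 (hn (.inr i) (hT i))
    simp [cost, e1, e2]
  have h2 : cost s γ S T (costMinimizer s γ S T) = 0 :=
    Nat.le_zero.1 (h1 ▸ cost_costMinimizer_le s γ S T n)
  have h3 : (Finset.univ.filter fun i => margin (costMinimizer s γ S T) (T i, s) ≤ 0).card = 0 :=
    (Nat.add_eq_zero_iff.1 h2).2
  rw [Finset.card_eq_zero, Finset.filter_eq_empty_iff] at h3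
  exact not_le.1 (h3 (Finset.mem_univ j))

theorem empLoss_nonneg {m : ℕ} (w : E d) (S : Fin m → Example d) : 0 ≤ empLoss w S := by
  unfold empLoss
  positivity

theorem empLoss_le_one {m : ℕ} (w : E d) (S : Fin m → Example d) : empLoss w S ≤ 1 := by
  refine div_le_one_of_le₀ ?_ (Nat.cast_nonneg m)
  exact_mod_cast (Finset.card_le_univ _).trans (by simp)

/-- Two predictors that label the sample by `1` and by `-1` have total error at least `1`. -/
theorem one_le_empLoss_add_empLoss {m : ℕ} (hm : 0 < m) {w w' : E d} {S : Fin m → Example d}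
    (hw : ∀ i, 0 < margin w ((S i).1, 1)) (hw' : ∀ i, 0 < margin w' ((S i).1, -1)) :
    1 ≤ empLoss w S + empLoss w' S := by
  classical
  have hcover : (Finset.univ : Finset (Fin m)) ⊆
      (Finset.univ.filter fun i => margin w (S i) ≤ 0) ∪
        Finset.univ.filter fun i => margin w' (S i) ≤ 0 := by
    intro i _
    have h1 := hw i
    have h2 := hw' i
    simp only [Finset.mem_union, Finset.mem_filter, Finset.mem_univ, true_and]
    simp only [margin] at h1 h2 ⊢
    rcases Int.units_eq_one_or (S i).2 with h | h <;> rw [h]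
    · right
      simp at h2 ⊢
      linarith
    · left
      simp at h1 ⊢
      linarith
  have hcard := (Finset.card_le_card hcover).trans (Finset.card_union_le _ _)
  rw [Finset.card_univ, Fintype.card_fin] at hcard
  unfold empLoss
  rw [← add_div, le_div_iff₀ (by exact_mod_cast hm), one_mul]
  exact_mod_cast hcard

theorem integrable_empLoss_predict (A : MarginErrorMinimizer d) {γ : ℝ} (hγ : 0 < γ) (m : ℕ)
    (P : Measure ((Fin m → Example d) × (Fin m → Example d))) [IsFiniteMeasure P] :
    Integrable (fun q => empLoss (A.predict γ m q.1 fun i => (q.2 i).1) q.2) P := by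
  have hpred : Measurable fun q : (Fin m → Example d) × (Fin m → Example d) =>
      A.predict γ m q.1 fun i => (q.2 i).1 :=
    (A.measurable_predict γ hγ m).comp
      (g := fun p : (Fin m → Example d) × (Fin m → E d) => A.predict γ m p.1 p.2)
      (f := fun q : (Fin m → Example d) × (Fin m → Example d) => (q.1, fun i => (q.2 i).1))
      (by fun_prop)
  have hmeas : Measurable fun q : (Fin m → Example d) × (Fin m → Example d) =>
      empLoss (A.predict γ m q.1 fun i => (q.2 i).1) q.2 := by
    unfold empLoss
    exact ((measurable_from_nat (f := fun n : ℕ => (n : ℝ))).comp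
      (measurable_card_filter_margin_le hpred measurable_snd 0)).div_const _
  refine Integrable.of_bound hmeas.aestronglyMeasurable 1 (ae_of_all _ fun q => ?_)
  rw [Real.norm_eq_abs, abs_of_nonneg (empLoss_nonneg _ _)]
  exact empLoss_le_one _ _

/-- The points of a training and a test sample together are independent draws from the marginal. -/
theorem measurePreserving_samplePoints (D : Measure (Example d)) [IsProbabilityMeasure D] (m : ℕ) :
    MeasurePreserving
      (fun (q : (Fin m → Example d) × (Fin m → Example d)) (i : Fin m ⊕ Fin m) =>
        (Sum.elim q.1 q.2 i).1)
      ((Measure.pi fun _ : Fin m => D).prod (Measure.pi fun _ : Fin m => D))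
      (Measure.pi fun _ : Fin m ⊕ Fin m => D.fst) := by
  have h1 := measurePreserving_sumPiEquivProdPi_symm (X := fun _ : Fin m ⊕ Fin m => Example d)
    fun _ => D
  have h2 := measurePreserving_pi (fun _ : Fin m ⊕ Fin m => D) (fun _ => D.fst)
    (f := fun _ => Prod.fst) fun _ => ⟨measurable_fst, rfl⟩
  have h3 := h2.comp h1
  convert h3 using 1
  funext q i
  rcases i with i | i <;> rfl

/-- If the points of a training and a test sample have a large Gram operator with probability at
least `1/2`, the two minimizers that favour a constant test label have total expected loss at least
`1/2`. -/
theorem half_le_expectedLoss_add_expectedLoss (D : Measure (Example d)) [IsProbabilityMeasure D]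
    {γ : ℝ} (hγ : 0 < γ) {m : ℕ} (hm : 0 < m) {c : ℝ} (hc : 2 * m * γ ^ 2 < c)
    {G : Set (Fin m ⊕ Fin m → E d)} (hG : MeasurableSet G)
    (hprob : 1 / 2 ≤ (Measure.pi fun _ : Fin m ⊕ Fin m => D.fst).real G)
    (hgram : ∀ ω ∈ G, ∀ v : EuclideanSpace ℝ (Fin m ⊕ Fin m),
      c * ‖v‖ ^ 2 ≤ ‖∑ j, v j • ω j‖ ^ 2) :
    1 / 2 ≤ expectedLoss (constantLabelMinimizer d 1) γ m D +
      expectedLoss (constantLabelMinimizer d (-1)) γ m D := by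
  have hne : Nonempty (Fin m ⊕ Fin m) := ⟨.inl ⟨0, hm⟩⟩
  set P := (Measure.pi fun _ : Fin m => D).prod (Measure.pi fun _ : Fin m => D) with hP
  have hmp := measurePreserving_samplePoints D m
  set f := fun (q : (Fin m → Example d) × (Fin m → Example d)) (i : Fin m ⊕ Fin m) =>
        (Sum.elim q.1 q.2 i).1 with hf
  have hsign : ∀ u : ℤˣ, (((u : ℤ) : ℝ)) ^ 2 = 1 := by
    intro u
    rcases Int.units_eq_one_or u with h | h <;> simp [h]
  have hpos : ∀ (s : ℤˣ) (q), f q ∈ G → ∀ j,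
      0 < margin ((constantLabelMinimizer d s).predict γ m q.1 fun i => (q.2 i).1)
        ((q.2 j).1, s) := by
    intro s q hq j
    -- The sign pattern has the true labels on the training points and `s` on all test points.
    obtain ⟨w, hw, hmargin⟩ := exists_margin_gt (f q) hγ (by simpa [two_mul, ← add_mul] using hc)
      (hgram _ hq) (Sum.elim (fun i => (((q.1 i).2 : ℤ) : ℝ)) fun _ => ((s : ℤ) : ℝ))
      (by rintro (i | i) <;> exact hsign _)
    exact margin_constantLabelMinimizer_pos (T := fun i => (q.2 i).1)
      (mem_closedBall_zero_iff.2 hw) (fun i => hmargin (.inl i))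
      (fun i => hγ.trans (hmargin (.inr i))) j
  unfold expectedLoss
  rw [← integral_add (integrable_empLoss_predict _ hγ m P) (integrable_empLoss_predict _ hγ m P)]
  rw [← hmp.measureReal_preimage hG.nullMeasurableSet] at hprob
  have hpre : MeasurableSet (f ⁻¹' G) := hmp.measurable hG
  refine hprob.trans ?_
  rw [← integral_indicator_one hpre]
  refine integral_mono ((integrable_const 1).indicator hpre)
    ((integrable_empLoss_predict _ hγ m P).add (integrable_empLoss_predict _ hγ m P)) fun q => ?_
  by_cases hq : f q ∈ G
  · rw [Set.indicator_of_mem (show q ∈ f ⁻¹' G from hq)]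
    exact one_le_empLoss_add_empLoss hm (hpos 1 q hq) (hpos (-1) q hq)
  · rw [Set.indicator_of_notMem (show q ∉ f ⁻¹' G from hq)]
    exact add_nonneg (empLoss_nonneg _ _) (empLoss_nonneg _ _)

end Algorithm


/-! ### Choice of constants and conclusion. -/

/-- The dimension-free constant of the lower bound for relative moment `ρ`. -/
noncomputable def concentrationRate (ρ : ℝ) : ℝ := 1 / (400 * (Real.exp 1 * ρ ^ 2 + 1) ^ 2)

theorem concentrationRate_pos (ρ : ℝ) : 0 < concentrationRate ρ := by
  unfold concentrationRate
  positivity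

theorem concentrationRate_le_one (ρ : ℝ) : concentrationRate ρ ≤ 1 := by
  unfold concentrationRate
  have h : (1 : ℝ) ≤ Real.exp 1 * ρ ^ 2 + 1 := by
    have : 0 ≤ Real.exp 1 * ρ ^ 2 := by positivity
    linarith
  rw [div_le_one (by positivity)]
  nlinarith

theorem four_mul_nine_pow_le_exp (n : ℕ) {x : ℝ} (hx : 3 * (n : ℝ) + 2 ≤ x) :
    4 * (9 : ℝ) ^ n ≤ Real.exp x := by
  have h2 : (2 : ℝ) ≤ Real.exp 1 := by linarith [Real.exp_one_gt_d9]
  have h4 : (4 : ℝ) ≤ Real.exp 2 := by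
    have : Real.exp 2 = Real.exp 1 * Real.exp 1 := by
      rw [← Real.exp_add]
      norm_num
    rw [this]
    nlinarith
  have h9 : (9 : ℝ) ≤ Real.exp 3 := by
    have h : Real.exp 3 = Real.exp 1 ^ 3 := by
      rw [← Real.exp_nat_mul]
      norm_num
    have h' : (2.7 : ℝ) ≤ Real.exp 1 := by linarith [Real.exp_one_gt_d9]
    rw [h]
    calc (9 : ℝ) ≤ 2.7 ^ 3 := by norm_num
      _ ≤ _ := by gcongr
  calc 4 * (9 : ℝ) ^ n ≤ Real.exp 2 * Real.exp 3 ^ n := by gcongr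
    _ = Real.exp (3 * n + 2) := by
      rw [← Real.exp_nat_mul, ← Real.exp_add]
      congr 1
      ring
    _ ≤ _ := Real.exp_le_exp.2 hx

/-- For samples small compared with the adapted dimension, some margin-error minimizer has expected
loss at least `1/4`. -/
theorem exists_quarter_le_expectedLoss {ρ : ℝ} (hρ : 0 < ρ) {d : ℕ} (D : Measure (Example d))
    [IsProbabilityMeasure D] (hD : IndepSubGaussian ρ D.fst) {γ : ℝ} (hγ : 0 < γ)
    (hk : 24 ≤ concentrationRate ρ * adaptedDim γ D.fst) {m : ℕ} (hm : 0 < m)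
    (hmk : (m : ℝ) ≤ concentrationRate ρ / 24 * adaptedDim γ D.fst) :
    ∃ A : MarginErrorMinimizer d, 1 / 4 ≤ expectedLoss A γ m D := by
  obtain ⟨a, hind, hsub⟩ := hD
  have hκ := concentrationRate_pos ρ
  have hκ1 := concentrationRate_le_one ρ
  set κ := concentrationRate ρ with hκdef
  set k := adaptedDim γ D.fst with hkdef
  have hk24 : (24 : ℝ) ≤ k := hk.trans (mul_le_of_le_one_left (Nat.cast_nonneg k) hκ1)
  have hκk : κ * k ≤ k := mul_le_of_le_one_left (Nat.cast_nonneg k) hκ1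
  have hint : ∀ i, Integrable (fun x : E d => (inner ℝ x (a i) : ℝ) ^ 2) D.fst := fun i =>
    (HasSubgaussianMGF.memLp (hsub i) 2).integrable_sq
  have hT : γ ^ 2 * ((k : ℝ) - 1) ≤ cappedTrace D.fst a (γ ^ 2) :=
    le_cappedTrace_of_adaptedDim hint (by
      have : 24 ≤ k := by exact_mod_cast hk24
      omega)
  have hγ2 : 0 < γ ^ 2 := by positivity
  obtain ⟨G, hG, hprob, hgram⟩ := exists_event_gram_lower_bound (ι := Fin m ⊕ Fin m) hρ hγ2 hind
    hsub (by
      -- With `2m` points this needs `6m + 2 ≤ κ (k - 1)`, which follows from `6m ≤ κ k / 4`, `κ ≤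
      -- 1` and `κ k ≥ 24`.
      refine four_mul_nine_pow_le_exp _ ?_
      have h1 : κ * ((k : ℝ) - 1) ≤ cappedTrace D.fst a (γ ^ 2) /
          (400 * (Real.exp 1 * ρ ^ 2 + 1) ^ 2 * γ ^ 2) := by
        rw [le_div_iff₀ (by positivity)]
        refine le_trans (le_of_eq ?_) hT
        rw [hκdef, concentrationRate]
        field_simp
      refine le_trans ?_ h1
      simp only [Fintype.card_sum, Fintype.card_fin]
      push_cast
      linarith)
  have hc : 2 * m * γ ^ 2 < cappedTrace D.fst a (γ ^ 2) / 2 := by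
    have : 4 * (m : ℝ) < k - 1 := by linarith
    nlinarith
  have hsum := half_le_expectedLoss_add_expectedLoss D hγ hm hc hG hprob hgram
  by_contra! hlt
  linarith [hlt (constantLabelMinimizer d 1), hlt (constantLabelMinimizer d (-1))]

end MarginLearning

theorem mainTheorem1 :
    ∀ ρ : ℝ, 0 < ρ → ∃ β : ℝ, 0 < β ∧ ∃ L₀ : ℕ,
      ∀ (d : ℕ) (D : Measure (MarginLearning.Example d)), IsProbabilityMeasure D →
        MarginLearning.IndepSubGaussian ρ D.fst →
        ∀ γ : ℝ, 0 < γ → L₀ < MarginLearning.adaptedDim γ D.fst →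
          ∀ ε : ℝ, ε < 1 / 4 - MarginLearning.optMarginLoss γ D →
            ENNReal.ofReal (β * (MarginLearning.adaptedDim γ D.fst : ℝ)) ≤
              ((MarginLearning.sampleComplexity ε γ D : ℕ∞) : ℝ≥0∞) := by
  intro ρ hρ
  have hκ := MarginLearning.concentrationRate_pos ρ
  -- The threshold forces `κ k / 24 ≥ 1`, so that samples of size `1` are within the allowed range.
  refine ⟨MarginLearning.concentrationRate ρ / 24, by positivity,
    ⌈24 / MarginLearning.concentrationRate ρ⌉₊, ?_⟩
  intro d D _ hD γ hγ hL ε hε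
  set κ := MarginLearning.concentrationRate ρ
  set k := MarginLearning.adaptedDim γ D.fst
  have hk : 24 ≤ κ * k := by
    have h1 : 24 / κ < k := (Nat.le_ceil _).trans_lt (by exact_mod_cast hL)
    rw [div_lt_iff₀ hκ] at h1
    linarith
  have hle : (⌈κ / 24 * k⌉₊ : ℕ∞) ≤ MarginLearning.sampleComplexity ε γ D := by
    refine le_iInf₂ fun N hN => ?_
    rw [Nat.cast_le, Nat.ceil_le]
    by_contra! hlt
    -- `N` may be `0`, but the lower bound on the loss needs a nonempty sample.
    have hm : ((max N 1 : ℕ) : ℝ) ≤ κ / 24 * k := by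
      rw [Nat.cast_max, Nat.cast_one]
      exact max_le hlt.le (by linarith)
    obtain ⟨A, hA⟩ := MarginLearning.exists_quarter_le_expectedLoss hρ D hD hγ hk
      (m := max N 1) (by omega) hm
    linarith [hN A (max N 1) (le_max_left N 1)]
  calc ENNReal.ofReal (κ / 24 * k) ≤ ((⌈κ / 24 * k⌉₊ : ℕ) : ℝ≥0∞) := by
        rw [← ENNReal.ofReal_natCast]
        exact ENNReal.ofReal_le_ofReal (Nat.le_ceil _)
    _ = (((⌈κ / 24 * k⌉₊ : ℕ) : ℕ∞) : ℝ≥0∞) := by simp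
    _ ≤ _ := ENat.toENNReal_le.2 hle
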